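/- Let $T>0$, $K\ge 1$, $\Omega=\{z\in\mathbb C:|\operatorname{Im}z|<T\}$, $D=d/dz$, and let $$\mathcal L=-D\,P_2(z)\,D+P_1(z)\,D+P_0(z)$$ be a regular operator: for $j=0,1,2$ the entries of the $K\times K$ matrix function $P_j$ are $2\pi$-periodic, analytic in $\Omega$, and have $j$ continuous complex derivatives on the closed strip $\overline\Omega$, and $\det P_2(z)\ne 0$ for all $z\in\overline\Omega$. Let $\oplus_K\mathbb L^2_{per}$ be the Hilbert space of $2\pi$-periodic locally square integrable functions $f:\mathbb R\to\mathbb C^K$ with $\langle f,g\rangle=\frac1{2\pi}\int_0^{2\pi}g^*(x)f(x)\,dx$ and norm $\|\cdot\|$. The operators $\mathcal L$ and $-D^2$ act in $\oplus_K\mathbb L^2_{per}$ on the common domain of those $f$ whose Fourier coefficients $c_n\in\mathbb C^K$ satisfy $\sum_{n\in\mathbb Z} n^4\|c_n\|^2<\infty$. Suppose that $\mathcal L$ is self-adjoint on $\oplus_K\mathbb L^2_{per}$, that $\langle\mathcal Lf,f\rangle\ge\|f\|^2$ for all $f$ in its domain, and that for some $C_0>0$ $$V^*P_2(x)V\ge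 C_0\|V\|^2\qquad\text{for all } V\in\mathbb C^K,\ 0\le x\le 2\pi .$$ Then there are constants $\alpha_1,\alpha_2>0$ such that for all $f$ in the domain of $-D^2$ $$\alpha_1\|\mathcal Lf\|\le\|(-D^2+I_K)f\|\le\alpha_2\|\mathcal Lf\| .$$ Moreover, the eigenvalues of $\mathcal L$ on $\oplus_K\mathbb L^2_{per}$ can be listed in increasing order with multiplicity as an infinite sequence $\lambda_1\le\lambda_2\le\cdots$ of real numbers, and there are $\beta_1,\beta_2>0$ such that for all sufficiently large integers $n$ $$\beta_1^2n^2\le\lambda_n\le\beta_2^2n^2 .$$ -/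

import Mathlib

open MeasureTheory

noncomputable section

namespace PerOp

instance twoPiPos : Fact (0 < 2 * Real.pi) := ⟨Real.two_pi_pos⟩

/-- The circle `ℝ / 2πℤ`; functions on it are the `2π`-periodic functions on the line. -/
abbrev Circ : Type := AddCircle (2 * Real.pi)

/-- The space of `2π`-periodic, locally square integrable complex functions.  The measure is
normalised to total mass one, so the inner product is
`(1 / 2π) ∫₀^{2π} f(x) * conj (g x) dx`. -/
abbrev L2per : Type := Lp ℂ 2 (AddCircle.haarAddCircle : Measure Circ)

/-- The Hilbert space direct sum of `K` copies of `L2per`. -/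
abbrev L2perK (K : ℕ) : Type := PiLp 2 (fun _ : Fin K => L2per)

/-- The square integrable periodic functions whose derivatives up to order `j` are square
integrable: `∑ |n|^{2j} |c_n|² < ∞` for the Fourier coefficients `c_n`. -/
def derivDomain (j : ℕ) : Submodule ℂ L2per where
  carrier := {f | Memℓp (fun n : ℤ => (Complex.I * n) ^ j * fourierCoeff f n) 2}
  zero_mem' := by
    change Memℓp _ 2
    convert (zero_memℓp : Memℓp (0 : ℤ → ℂ) 2) using 1
    funext n
    rw [← fourierBasis_repr]
    simp
  add_mem' := by
    intro f g hf hg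
    change Memℓp _ 2 at hf hg ⊢
    simp only [← fourierBasis_repr] at hf hg ⊢
    convert hf.add hg using 1
    funext n
    simp [mul_add]
  smul_mem' := by
    intro c f hf
    change Memℓp _ 2 at hf ⊢
    simp only [← fourierBasis_repr] at hf ⊢
    convert hf.const_smul c using 1
    funext n
    simp [mul_left_comm]

/-- The operator `D^j`, `D = d/dx`, on its maximal domain in `L2per`: the function with Fourier
coefficients `c_n` goes to the function with Fourier coefficients `(i n)^j c_n`. -/
def derivOp (j : ℕ) : L2per →ₗ.[ℂ] L2per where
  domain := derivDomain j
  toFun :=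
    { toFun := fun f => fourierBasis.repr.symm
        ⟨fun n : ℤ => (Complex.I * n) ^ j * fourierCoeff (f : L2per) n, f.2⟩
      map_add' := by
        intro f g
        rw [← map_add]
        congr 1
        ext n
        simp only [← fourierBasis_repr, lp.coeFn_add, Pi.add_apply]
        simp [mul_add]
      map_smul' := by
        intro c f
        rw [← map_smul]
        congr 1
        ext n
        simp only [← fourierBasis_repr]
        simp [mul_left_comm] }

theorem derivDomain_two_le_one : derivDomain 2 ≤ derivDomain 1 := by
  intro f hf
  refine Memℓp.mono' (g := fun n : ℤ => (Complex.I * n) ^ 2 * fourierCoeff f n) hf ?_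
  intro n
  simp only [norm_mul, norm_pow, Complex.norm_I, one_mul, Complex.norm_intCast, pow_one]
  refine mul_le_mul_of_nonneg_right ?_ (norm_nonneg _)
  rcases eq_or_ne n 0 with rfl | hn
  · simp
  · have h1 : (1 : ℝ) ≤ |(n : ℝ)| := by exact_mod_cast Int.one_le_abs hn
    nlinarith

/-- The diagonal operator `I_K D^j` on `L2perK K`. -/
def derivOpK (K j : ℕ) : L2perK K →ₗ.[ℂ] L2perK K where
  domain :=
    { carrier := {f | ∀ i, f i ∈ derivDomain j}
      zero_mem' := fun _ => zero_mem _
      add_mem' := fun hf hg i => add_mem (hf i) (hg i)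
      smul_mem' := fun c _ hf i => Submodule.smul_mem _ c (hf i) }
  toFun :=
    { toFun := fun f => WithLp.toLp 2 (fun i => derivOp j ⟨f.1 i, f.2 i⟩)
      map_add' := by
        intro f g
        ext1 i
        exact (derivOp j).map_add ⟨f.1 i, f.2 i⟩ ⟨g.1 i, g.2 i⟩
      map_smul' := by
        intro c f
        ext1 i
        exact (derivOp j).map_smul c ⟨f.1 i, f.2 i⟩ }

theorem derivOpK_domain_two_le_one (K : ℕ) :
    (derivOpK K 2).domain ≤ (derivOpK K 1).domain :=
  fun _ hf i => derivDomain_two_le_one (hf i)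

/-- The operator `-D² + I_K`, on the domain of `I_K D²`. -/
def negD2AddOne (K : ℕ) : L2perK K →ₗ.[ℂ] L2perK K where
  domain := (derivOpK K 2).domain
  toFun := -(derivOpK K 2).toFun + (derivOpK K 2).domain.subtype

theorem memLp_mul (a : C(Circ, ℂ)) (f : L2per) :
    MemLp (fun x => a x * f x) 2 (AddCircle.haarAddCircle : Measure Circ) := by
  obtain ⟨C, hC⟩ := (isCompact_range a.continuous).isBounded.exists_norm_le
  refine MemLp.of_le_mul (c := C) (Lp.memLp f)
    (a.continuous.aestronglyMeasurable.mul (Lp.aestronglyMeasurable f)) ?_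
  filter_upwards with x
  rw [norm_mul]
  exact mul_le_mul_of_nonneg_right (hC _ ⟨x, rfl⟩) (norm_nonneg _)

/-- Multiplication by a continuous periodic function. -/
def mulOp (a : C(Circ, ℂ)) : L2per →ₗ[ℂ] L2per where
  toFun f := (memLp_mul a f).toLp
  map_add' f g := by
    rw [← MemLp.toLp_add]
    refine MemLp.toLp_congr _ _ ?_
    filter_upwards [Lp.coeFn_add f g] with x hx
    simp only [hx, Pi.add_apply, mul_add]
  map_smul' c f := by
    rw [RingHom.id_apply, ← MemLp.toLp_const_smul]
    refine MemLp.toLp_congr _ _ ?_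
    filter_upwards [Lp.coeFn_smul c f] with x hx
    simp only [hx, Pi.smul_apply, smul_eq_mul, mul_left_comm]

/-- Multiplication of column vectors by a continuous periodic matrix. -/
def matMulOp {K : ℕ} (A : Matrix (Fin K) (Fin K) C(Circ, ℂ)) : L2perK K →ₗ[ℂ] L2perK K where
  toFun f := WithLp.toLp 2 (fun i => ∑ j, mulOp (A i j) (f j))
  map_add' f g := by
    ext1 i
    simp [Finset.sum_add_distrib]
  map_smul' c f := by
    ext1 i
    simp [Finset.smul_sum]

/-- The open strip `{|Im z| < T}`. -/
def openStrip (T : ℝ) : Set ℂ := {z | |z.im| < T}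

/-- The closed strip `{|Im z| ≤ T}`. -/
def closedStrip (T : ℝ) : Set ℂ := {z | |z.im| ≤ T}

/-- A scalar coefficient: `2π`-periodic, analytic in the open strip, with `j` continuous complex
derivatives on the closed strip.  (Such a function is bounded, hence lies in the Hardy space of
the strip.) -/
structure IsCoeff (T : ℝ) (j : ℕ) (a : ℂ → ℂ) : Prop where
  periodic : ∀ z ∈ closedStrip T, a (z + 2 * Real.pi) = a z
  analytic : DifferentiableOn ℂ a (openStrip T)
  contDiff : ContDiffOn ℂ j a (closedStrip T)

/-- A regular second order operator `-D P₂(z) D + P₁(z) D + P₀(z)` with `K × K` matrix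
coefficients on the strip `{|Im z| < T}`. -/
structure RegularOperator (T : ℝ) (K : ℕ) where
  T_pos : 0 < T
  P₂ : ℂ → Matrix (Fin K) (Fin K) ℂ
  P₁ : ℂ → Matrix (Fin K) (Fin K) ℂ
  P₀ : ℂ → Matrix (Fin K) (Fin K) ℂ
  coeff₂ : ∀ i j, IsCoeff T 2 (fun z => P₂ z i j)
  coeff₁ : ∀ i j, IsCoeff T 1 (fun z => P₁ z i j)
  coeff₀ : ∀ i j, IsCoeff T 0 (fun z => P₀ z i j)
  det_ne_zero : ∀ z ∈ closedStrip T, (P₂ z).det ≠ 0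

theorem ofReal_mem_openStrip {T : ℝ} (hT : 0 < T) (x : ℝ) : (x : ℂ) ∈ openStrip T := by
  simpa [openStrip] using hT

theorem isOpen_openStrip (T : ℝ) : IsOpen (openStrip T) :=
  isOpen_lt (by fun_prop) continuous_const

theorem openStrip_subset (T : ℝ) : openStrip T ⊆ closedStrip T :=
  fun z (h : |z.im| < T) => show |z.im| ≤ T from le_of_lt h

/-- The restriction to the real axis of a function on the strip, as a function on the circle. -/
def realTrace (a : ℂ → ℂ) (hc : Continuous fun x : ℝ => a x)
    (hp : Function.Periodic (fun x : ℝ => a x) (2 * Real.pi)) : C(Circ, ℂ) where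
  toFun := hp.lift
  continuous_toFun := continuous_coinduced_dom.mpr hc

namespace IsCoeff

variable {T : ℝ} {j : ℕ} {a : ℂ → ℂ}

theorem continuous_real (h : IsCoeff T j a) (hT : 0 < T) : Continuous fun x : ℝ => a x :=
  h.analytic.continuousOn.comp_continuous Complex.continuous_ofReal
    (fun x => ofReal_mem_openStrip hT x)

theorem periodic_real (h : IsCoeff T j a) (hT : 0 < T) :
    Function.Periodic (fun x : ℝ => a x) (2 * Real.pi) := by
  intro x
  have := h.periodic x (openStrip_subset T (ofReal_mem_openStrip hT x))
  simpa using this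

theorem continuous_deriv_real (h : IsCoeff T j a) (hT : 0 < T) :
    Continuous fun x : ℝ => deriv a x :=
  (h.analytic.deriv (isOpen_openStrip T)).continuousOn.comp_continuous Complex.continuous_ofReal
    (fun x => ofReal_mem_openStrip hT x)

theorem periodic_deriv_real (h : IsCoeff T j a) (hT : 0 < T) :
    Function.Periodic (fun x : ℝ => deriv a x) (2 * Real.pi) := by
  intro x
  have hev : (fun z => a (z + 2 * Real.pi)) =ᶠ[nhds (x : ℂ)] a := by
    filter_upwards [(isOpen_openStrip T).mem_nhds (ofReal_mem_openStrip hT x)] with z hz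
    exact h.periodic z (openStrip_subset T hz)
  have h2 := hev.deriv_eq
  rw [deriv_comp_add_const] at h2
  simpa using h2

end IsCoeff

namespace RegularOperator

variable {T : ℝ} {K : ℕ} (L : RegularOperator T K)

/-- `P₂(x)` on the real axis. -/
def P₂c : Matrix (Fin K) (Fin K) C(Circ, ℂ) := fun i j =>
  realTrace (fun z => L.P₂ z i j) ((L.coeff₂ i j).continuous_real L.T_pos)
    ((L.coeff₂ i j).periodic_real L.T_pos)

/-- The derivative `P₂'(x)` on the real axis. -/
def dP₂c : Matrix (Fin K) (Fin K) C(Circ, ℂ) := fun i j =>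
  realTrace (deriv fun z => L.P₂ z i j) ((L.coeff₂ i j).continuous_deriv_real L.T_pos)
    ((L.coeff₂ i j).periodic_deriv_real L.T_pos)

/-- `P₁(x)` on the real axis. -/
def P₁c : Matrix (Fin K) (Fin K) C(Circ, ℂ) := fun i j =>
  realTrace (fun z => L.P₁ z i j) ((L.coeff₁ i j).continuous_real L.T_pos)
    ((L.coeff₁ i j).periodic_real L.T_pos)

/-- `P₀(x)` on the real axis. -/
def P₀c : Matrix (Fin K) (Fin K) C(Circ, ℂ) := fun i j =>
  realTrace (fun z => L.P₀ z i j) ((L.coeff₀ i j).continuous_real L.T_pos)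
    ((L.coeff₀ i j).periodic_real L.T_pos)

/-- The operator on `L2perK K`, with the domain of `I_K D²`, given by
`L f = -D (P₂ D f) + P₁ D f + P₀ f = -P₂ D² f + (P₁ - P₂') D f + P₀ f`. -/
def op : L2perK K →ₗ.[ℂ] L2perK K where
  domain := (derivOpK K 2).domain
  toFun :=
    -(matMulOp L.P₂c ∘ₗ (derivOpK K 2).toFun)
      + matMulOp (L.P₁c - L.dP₂c) ∘ₗ (derivOpK K 1).toFun ∘ₗ
          Submodule.inclusion (derivOpK_domain_two_le_one K)
      + matMulOp L.P₀c ∘ₗ (derivOpK K 2).domain.subtype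

end RegularOperator

/-- The eigenspace `{f ∈ dom A | A f = μ f}`. -/
def eigenspace {H : Type*} [AddCommGroup H] [Module ℂ H] (A : H →ₗ.[ℂ] H) (μ : ℂ) :
    Submodule ℂ A.domain :=
  LinearMap.ker (A.toFun - μ • A.domain.subtype)

/-- `lam 1 ≤ lam 2 ≤ …` lists all eigenvalues of `A` in increasing order, each one as many times
as its multiplicity (the dimension of its eigenspace). -/
structure IsEigenvalueList {H : Type*} [AddCommGroup H] [Module ℂ H] (A : H →ₗ.[ℂ] H)
    (lam : ℕ+ → ℝ) : Prop where
  monotone : Monotone lam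
  multiplicity : ∀ μ : ℂ,
    {n : ℕ+ | (lam n : ℂ) = μ}.encard = Cardinal.toENat (Module.rank ℂ (eigenspace A μ))

end PerOp

end

/-! The norm equivalence is an elliptic estimate. Integrating the pointwise bound on `P₂` shows that
multiplication by `P₂` is bounded below by `C₀`, so `D²f` is controlled by `P₂D²f`, that is, by `Lf`
and the terms of lower order. The interpolation `‖Df‖ ≤ ε‖D²f‖ + ε⁻¹‖f‖` absorbs the first order
term, and positivity gives `‖f‖ ≤ ‖Lf‖` (`exists_norm_negD2AddOne_le`). The reverse bound only needs
bounded coefficients.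

The operator `-D² + 1` is diagonal on the Fourier modes with weights `1 + k²`, each frequency
occurring `K` times. As it is dominated by `L` and its weights tend to infinity, `L⁻¹` is a norm
limit of finite rank operators, so `L` has an orthonormal eigenbasis.

The eigenvalue growth is a dimension count on norms rather than quadratic forms: the span of many
vectors of one basis contains a nonzero vector orthogonal to fewer vectors of the other. Comparing
`‖Lx‖` with `‖(-D² + 1)x‖` at that vector, in both directions, bounds `λₙ` above and below
(`le_of_card_lt`, `le_of_lt_card`). Every eigenvalue list is a reindexing of the eigenbasis, so the
bounds apply to any list. -/

/-! ### Hilbert bases and the spectral theorem for self-adjoint operators with compact inverse -/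

section Hilbert

universe u v

variable {H : Type u} [NormedAddCommGroup H] [InnerProductSpace ℂ H]

theorem HilbertBasis.hasSum_sq_norm_repr {ι : Type*} (b : HilbertBasis ι ℂ H) (x : H) :
    HasSum (fun j => ‖b.repr x j‖ ^ 2) (‖x‖ ^ 2) := by
  have h := lp.hasSum_norm (p := 2) (by norm_num) (b.repr x)
  simpa using h

/-- Parseval reduces a norm inequality to one between coefficients. It serves both the Fourier basis
and the eigenbasis. -/
theorem HilbertBasis.norm_le_of_repr_le {ι : Type*} (b : HilbertBasis ι ℂ H) {x y : H} {C : ℝ}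
    (hC : 0 ≤ C) (h : ∀ j, ‖b.repr x j‖ ≤ C * ‖b.repr y j‖) : ‖x‖ ≤ C * ‖y‖ := by
  have h1 := hasSum_le (fun j => ?_) (b.hasSum_sq_norm_repr x)
    ((b.hasSum_sq_norm_repr y).mul_left (C ^ 2))
  · rw [← mul_pow] at h1
    exact le_of_sq_le_sq h1 (by positivity)
  · rw [← mul_pow]
    exact pow_le_pow_left₀ (norm_nonneg _) (h j) 2

/-- Vanishing inner products can be achieved in the span of sufficiently many vectors. -/
theorem exists_ne_zero_sum_smul_orthogonal {α β : Type*} [Fintype α] [Fintype β]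
    (h : Fintype.card β < Fintype.card α) (v : α → H) (u : β → H) :
    ∃ c : α → ℂ, c ≠ 0 ∧ ∀ j, inner ℂ (u j) (∑ i, c i • v i) = 0 := by
  let f : (α → ℂ) →ₗ[ℂ] (β → ℂ) := LinearMap.pi fun j =>
    (innerₛₗ ℂ (u j)) ∘ₗ (Fintype.linearCombination ℂ v)
  have hf : LinearMap.ker f ≠ ⊥ := LinearMap.ker_ne_bot_of_finrank_lt (by simpa using h)
  obtain ⟨c, hc, hc0⟩ := Submodule.exists_mem_ne_zero_of_ne_bot hf
  refine ⟨c, hc0, fun j => ?_⟩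
  have := congrFun (LinearMap.mem_ker.mp hc) j
  simp only [f, LinearMap.pi_apply, LinearMap.comp_apply, innerₛₗ_apply_apply,
    Fintype.linearCombination_apply] at this
  exact this

/-- A nonzero vector in the span of one part of a Hilbert basis, orthogonal to a smaller part of
another one. -/
theorem HilbertBasis.exists_repr_eq_zero {ι κ : Type*} (b : HilbertBasis ι ℂ H)
    (e : HilbertBasis κ ℂ H) (S : Finset ι) (F : Finset κ) (h : F.card < S.card) :
    ∃ x ∈ Submodule.span ℂ (b '' S), x ≠ 0 ∧ (∀ i ∉ S, b.repr x i = 0) ∧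
      ∀ j ∈ F, e.repr x j = 0 := by
  classical
  obtain ⟨c, hc, hx⟩ := exists_ne_zero_sum_smul_orthogonal (α := S) (β := F) (by simpa using h)
    (fun i => b i) (fun j => e j)
  refine ⟨∑ i, c i • b i, ?_, ?_, ?_, ?_⟩
  · exact Submodule.sum_mem _ fun i _ => Submodule.smul_mem _ _
      (Submodule.subset_span ⟨i, i.2, rfl⟩)
  · intro h0
    apply hc
    have hli : LinearIndependent ℂ (fun i : S => b i) :=
      b.orthonormal.linearIndependent.comp _ Subtype.val_injective
    exact funext (Fintype.linearIndependent_iff.mp hli c h0)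
  · intro i hi
    rw [b.repr_apply_apply, inner_sum]
    refine Finset.sum_eq_zero fun j _ => ?_
    rw [inner_smul_right, b.orthonormal.2 (by rintro rfl; exact hi j.2), mul_zero]
  · intro j hj
    rw [e.repr_apply_apply]
    exact hx ⟨j, hj⟩

/-- Hilbert bases of mutually orthogonal subspaces with dense sum combine to a Hilbert basis. -/
theorem OrthogonalFamily.exists_hilbertBasis_mem [CompleteSpace H] {α : Type v}
    {V : α → Submodule ℂ H} [∀ a, CompleteSpace (V a)]
    (hV : OrthogonalFamily ℂ (fun a => V a) fun a => (V a).subtypeₗᵢ) (hbot : (⨆ a, V a)ᗮ = ⊥) :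
    ∃ (ι : Type (max v u)) (e : HilbertBasis ι ℂ H) (ν : ι → α), ∀ i, e i ∈ V (ν i) := by
  choose w b hb using fun a => exists_hilbertBasis ℂ (V a)
  let v : (Σ a, w a) → H := fun a => ((b a.1 a.2 : V a.1) : H)
  have hon : Orthonormal ℂ v := hV.orthonormal_sigma_orthonormal (fun a => (b a).orthonormal)
  have hspan : (Submodule.span ℂ (Set.range v))ᗮ = ⊥ := by
    rw [Submodule.eq_bot_iff]
    intro y hy
    rw [← Submodule.mem_bot ℂ, ← hbot, ← Submodule.iInf_orthogonal, Submodule.mem_iInf]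
    intro a
    rw [Submodule.mem_orthogonal']
    intro u hu
    let φ : V a →L[ℂ] ℂ := (innerSL ℂ y).comp (Submodule.subtypeL _)
    -- Pairing with `y` is continuous and vanishes on the basis of `V a`, whose span is dense.
    have hle : (⊤ : Submodule ℂ (V a)) ≤ φ.ker := by
      rw [← (b a).dense_span]
      refine Submodule.topologicalClosure_minimal _ ?_ φ.isClosed_ker
      rw [Submodule.span_le]
      rintro _ ⟨i, rfl⟩
      exact (Submodule.mem_orthogonal' _ _).mp hy _ (Submodule.subset_span ⟨⟨a, i⟩, rfl⟩)
    exact hle (Submodule.mem_top : (⟨u, hu⟩ : V a) ∈ _)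
  have hco : ⇑(HilbertBasis.mkOfOrthogonalEqBot hon hspan) = v :=
    HilbertBasis.coe_mkOfOrthogonalEqBot hon hspan
  refine ⟨_, HilbertBasis.mkOfOrthogonalEqBot hon hspan, fun i => i.1, fun i => ?_⟩
  rw [hco]
  exact (b i.1 i.2).2

/-- A compact symmetric operator has a Hilbert basis of eigenvectors. -/
theorem ContinuousLinearMap.exists_hilbertBasis_eigenvectors [CompleteSpace H] (B : H →L[ℂ] H)
    (hBc : IsCompactOperator B) (hsymm : (B : H →ₗ[ℂ] H).IsSymmetric) :
    ∃ (ι : Type u) (e : HilbertBasis ι ℂ H) (ν : ι → ℂ),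
      ∀ i, B (e i) = ν i • e i ∧ (starRingEnd ℂ) (ν i) = ν i := by
  have : ∀ ν : ℂ, CompleteSpace (Module.End.eigenspace (B : H →ₗ[ℂ] H) ν) := fun ν => by
    have hcl : IsClosed (Module.End.eigenspace (B : H →ₗ[ℂ] H) ν : Set H) := by
      have : (Module.End.eigenspace (B : H →ₗ[ℂ] H) ν : Set H) = {x | B x = ν • x} := by
        ext x
        exact Module.End.mem_eigenspace_iff
      rw [this]
      exact isClosed_eq B.continuous (continuous_const_smul ν)
    exact hcl.completeSpace_coe
  obtain ⟨ι, e, ν, he⟩ := hsymm.orthogonalFamily_eigenspaces.exists_hilbertBasis_mem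
    (ContinuousLinearMap.orthogonalComplement_iSup_eigenspaces_eq_bot hBc hsymm)
  exact ⟨ι, e, ν, fun i => ⟨Module.End.mem_eigenspace_iff.mp (he i),
    hsymm.conj_eigenvalue_eq_self
      (Module.End.hasEigenvalue_of_hasEigenvector ⟨he i, e.orthonormal.ne_zero i⟩)⟩⟩

namespace LinearPMap

variable {A : H →ₗ.[ℂ] H}

/-- Cauchy–Schwarz, then division by `‖f‖`. This yields injectivity and closed range, and later
controls the zeroth order term. -/
theorem norm_le_norm_apply
    (hpos : ∀ f : A.domain, ‖(f : H)‖ ^ 2 ≤ (inner ℂ (f : H) (A f)).re) (f : A.domain) :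
    ‖(f : H)‖ ≤ ‖A f‖ := by
  have h : ‖(f : H)‖ ^ 2 ≤ ‖(f : H)‖ * ‖A f‖ := (hpos f).trans (re_inner_le_norm (𝕜 := ℂ) _ _)
  rcases (norm_nonneg (f : H)).eq_or_lt with h0 | h0
  · rw [← h0]
    exact norm_nonneg _
  · rw [sq] at h
    exact le_of_mul_le_mul_left h h0

variable [CompleteSpace H]

theorem inner_apply_comm (hA : IsSelfAdjoint A) (x y : A.domain) :
    inner ℂ (A x) (y : H) = inner ℂ (x : H) (A y) := by
  have h := adjoint_isFormalAdjoint hA.dense_domain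
  rw [isSelfAdjoint_def.mp hA] at h
  exact h x y

/-- A self-adjoint operator bounded below by `1` is onto. -/
theorem exists_apply_eq (hA : IsSelfAdjoint A)
    (hpos : ∀ f : A.domain, ‖(f : H)‖ ^ 2 ≤ (inner ℂ (f : H) (A f)).re) (g : H) :
    ∃ f : A.domain, A f = g := by
  -- The range is the second projection of the graph, which is complete; by `norm_le_norm_apply` the
  -- projection is bounded below there.
  have hcl : _root_.IsClosed (LinearMap.range A.toFun : Set H) := by
    have : CompleteSpace A.graph :=
      (show _root_.IsClosed (A.graph : Set (H × H)) from hA.isClosed).completeSpace_coe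
    let S : A.graph →L[ℂ] H := (ContinuousLinearMap.snd ℂ H H).comp A.graph.subtypeL
    have hS : AntilipschitzWith 1 S := by
      refine ContinuousLinearMap.antilipschitz_of_bound S fun x => ?_
      obtain ⟨⟨x1, x2⟩, hx⟩ := x
      obtain ⟨y, rfl, rfl⟩ := (mem_graph_iff A).mp hx
      have := norm_le_norm_apply hpos y
      simpa [S, Prod.norm_def] using this
    have h := hS.isClosed_range S.uniformContinuous
    convert h using 1
    ext z
    constructor
    · rintro ⟨y, rfl⟩
      exact ⟨⟨_, A.mem_graph y⟩, rfl⟩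
    · rintro ⟨⟨⟨x1, x2⟩, hx⟩, rfl⟩
      obtain ⟨y, rfl, rfl⟩ := (mem_graph_iff A).mp hx
      exact ⟨y, rfl⟩
  have : CompleteSpace (LinearMap.range A.toFun) := hcl.completeSpace_coe
  have hbot : (LinearMap.range A.toFun)ᗮ = ⊥ := by
    rw [Submodule.eq_bot_iff]
    intro y hy
    -- Orthogonality to the range puts `y` in the domain of the adjoint, which is that of `A`; then
    -- `⟨y, Ay⟩ = 0` and positivity forces `y = 0`.
    have hy' : ∀ x : A.domain, inner ℂ (0 : H) (x : H) = inner ℂ y (A x) := fun x => by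
      rw [inner_zero_left]
      exact ((Submodule.mem_orthogonal' _ _).mp hy _ ⟨x, rfl⟩).symm
    have hmem : y ∈ A.domain := by
      have := mem_adjoint_domain_of_exists (T := A) y ⟨0, hy'⟩
      rwa [isSelfAdjoint_def.mp hA] at this
    have h2 := hpos ⟨y, hmem⟩
    rw [← hy' ⟨y, hmem⟩] at h2
    simpa using h2
  have htop := Submodule.orthogonal_eq_bot_iff.mp hbot
  have hg : g ∈ LinearMap.range A.toFun := htop ▸ Submodule.mem_top
  exact hg

/-- The bounded inverse of a self-adjoint operator bounded below by `1`. -/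
theorem exists_inverse (hA : IsSelfAdjoint A)
    (hpos : ∀ f : A.domain, ‖(f : H)‖ ^ 2 ≤ (inner ℂ (f : H) (A f)).re) :
    ∃ B : H →L[ℂ] H, ∀ g, ∃ h : B g ∈ A.domain, A ⟨B g, h⟩ = g := by
  choose B hB using exists_apply_eq hA hpos
  have hinj : ∀ x y : A.domain, A x = A y → x = y := fun x y hxy => by
    have h := norm_le_norm_apply hpos (x - y)
    rw [A.map_sub, hxy, sub_self, norm_zero] at h
    have h' : ((x - y : A.domain) : H) = 0 := norm_le_zero_iff.mp h
    exact sub_eq_zero.mp (Subtype.ext h')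
  let B' : H →ₗ[ℂ] H :=
    { toFun := fun g => B g
      map_add' := fun x y => by
        rw [← Submodule.coe_add]
        exact congrArg _ (hinj _ _ (by rw [A.map_add, hB, hB, hB]))
      map_smul' := fun c x => by
        rw [RingHom.id_apply, ← Submodule.coe_smul]
        exact congrArg _ (hinj _ _ (by rw [A.map_smul, hB, hB])) }
  refine ⟨B'.mkContinuous 1 fun g => ?_, fun g => ⟨(B g).2, hB g⟩⟩
  have := norm_le_norm_apply hpos (B g)
  rw [hB] at this
  simpa [B'] using this

/-- A family of eigenvectors of `A` for the values `μ`. -/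
def IsEigenfamily {ι : Type*} (A : H →ₗ.[ℂ] H) (e : ι → H) (μ : ι → ℝ) : Prop :=
  ∀ i, ∃ h : e i ∈ A.domain, A ⟨e i, h⟩ = (μ i : ℂ) • e i

/-- Symmetry moves `A` onto the basis vector, so `A` is diagonal in `e` on its whole domain. -/
theorem IsEigenfamily.repr_apply {ι : Type*} {e : HilbertBasis ι ℂ H} {μ : ι → ℝ}
    (he : IsEigenfamily A e μ) (hA : IsSelfAdjoint A) (f : A.domain) (i : ι) :
    e.repr (A f) i = μ i * e.repr (f : H) i := by
  obtain ⟨h, hi⟩ := he i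
  rw [e.repr_apply_apply, e.repr_apply_apply, ← inner_apply_comm hA ⟨e i, h⟩ f, hi,
    inner_smul_left, Complex.conj_ofReal]

/-- A self-adjoint operator with compact inverse has a Hilbert basis of eigenvectors. -/
theorem exists_eigenbasis (hA : IsSelfAdjoint A) (B : H →L[ℂ] H) (hBc : IsCompactOperator B)
    (hB : ∀ g, ∃ h : B g ∈ A.domain, A ⟨B g, h⟩ = g) :
    ∃ (ι : Type u) (e : HilbertBasis ι ℂ H) (μ : ι → ℝ), IsEigenfamily A e μ := by
  have hsymm : (B : H →ₗ[ℂ] H).IsSymmetric := fun x y => by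
    obtain ⟨hx, hx'⟩ := hB x
    obtain ⟨hy, hy'⟩ := hB y
    have := inner_apply_comm hA ⟨B x, hx⟩ ⟨B y, hy⟩
    rw [hx', hy'] at this
    exact this.symm
  obtain ⟨ι, e, ν, hν⟩ := B.exists_hilbertBasis_eigenvectors hBc hsymm
  -- The eigenvalues `ν a` of the inverse are real and nonzero, so taking the real part of `(ν a)⁻¹`
  -- loses nothing.
  refine ⟨ι, e, fun a => ((ν a)⁻¹).re, fun a => ?_⟩
  have hne : e a ≠ 0 := e.orthonormal.ne_zero a
  obtain ⟨hev, hreal⟩ := hν a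
  obtain ⟨hm, hm'⟩ := hB (e a)
  have ha : ν a ≠ 0 := by
    intro h0
    rw [h0, zero_smul] at hev
    apply hne
    rw [← hm']
    have : (⟨B (e a), hm⟩ : A.domain) = 0 := Subtype.ext hev
    rw [this, A.map_zero]
  have hva : e a = (ν a)⁻¹ • B (e a) := by rw [hev, smul_smul, inv_mul_cancel₀ ha, one_smul]
  have hmem : e a ∈ A.domain := by
    rw [hva]
    exact Submodule.smul_mem _ _ hm
  refine ⟨hmem, ?_⟩
  have h1 : (⟨e a, hmem⟩ : A.domain) = (ν a)⁻¹ • ⟨B (e a), hm⟩ := Subtype.ext hva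
  have h2 : ((((ν a)⁻¹).re : ℝ) : ℂ) = (ν a)⁻¹ := by
    rw [← Complex.conj_eq_iff_re, map_inv₀, hreal]
  rw [h1, A.map_smul, hm', h2]

end LinearPMap

end Hilbert

/-! ### Comparison of a self-adjoint operator with a diagonal one -/

section DiagonalComparison

universe u v

variable {H : Type u} [NormedAddCommGroup H] [InnerProductSpace ℂ H] [CompleteSpace H]
  {A : H →ₗ.[ℂ] H} {κ : Type v} {b : HilbertBasis κ ℂ H} {w : κ → ℝ} {M : A.domain → H}

namespace LinearPMap

/-- If a diagonal operator with weights tending to infinity is bounded by `A`, then the inverse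
of `A` is compact. -/
theorem isCompactOperator_inverse_of_diagonal {C : ℝ} (hC : 0 ≤ C)
    (hM : ∀ f j, b.repr (M f) j = w j * b.repr (f : H) j) (hMA : ∀ f, ‖M f‖ ≤ C * ‖A f‖)
    (hw : ∀ R : ℝ, ∃ F : Finset κ, ∀ j ∉ F, R ≤ w j)
    (B : H →L[ℂ] H) (hB : ∀ g, ∃ h : B g ∈ A.domain, A ⟨B g, h⟩ = g) : IsCompactOperator B := by
  classical
  choose F hF using fun n : ℕ => hw (n + 1)
  -- The finite rank approximants are `B` followed by projection onto the modes in `F n`. On the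
  -- other modes `w j ≥ n + 1`, so the error is at most `C / (n + 1)`.
  let P : κ → H →L[ℂ] H := fun j =>
    ((ContinuousLinearMap.toSpanSingleton ℂ (b j)).comp (innerSL ℂ (b j))).comp B
  have hP : ∀ j g, P j g = inner ℂ (b j) (B g) • b j := fun j g => by simp [P]
  have hPc : ∀ s : Finset κ, IsCompactOperator (∑ j ∈ s, P j : H →L[ℂ] H) := fun s => by
    have : ∑ j ∈ s, P j ∈ compactOperator (RingHom.id ℂ) H H := by
      refine Submodule.sum_mem _ fun j _ => ?_
      exact ((isCompactOperator_of_locallyCompactSpace_rng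
        (ContinuousLinearMap.toSpanSingleton ℂ (b j))).comp_clm (innerSL ℂ (b j))).comp_clm B
    exact this
  refine isCompactOperator_of_tendsto (l := Filter.atTop)
    (F := fun n : ℕ => ∑ j ∈ F n, P j) ?_ (Filter.Eventually.of_forall fun n => hPc _)
  rw [tendsto_iff_norm_sub_tendsto_zero]
  have hlim : Filter.Tendsto (fun n : ℕ => C * (1 / ((n : ℝ) + 1))) Filter.atTop (nhds 0) := by
    simpa using tendsto_one_div_add_atTop_nhds_zero_nat.const_mul C
  refine squeeze_zero (fun _ => norm_nonneg _) (fun n => ?_) hlim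
  have hn : (0 : ℝ) < n + 1 := by positivity
  refine ContinuousLinearMap.opNorm_le_bound _ (by positivity) fun g => ?_
  obtain ⟨h, hg⟩ := hB g
  have hrepr : ∀ j, b.repr ((∑ j ∈ F n, P j - B) g) j =
      if j ∈ F n then 0 else - b.repr (B g) j := fun j => by
    rw [_root_.sub_apply, _root_.sum_apply, b.repr_apply_apply,
      b.repr_apply_apply, inner_sub_right, inner_sum]
    simp only [hP, inner_smul_right, orthonormal_iff_ite.mp b.orthonormal, mul_ite, mul_one,
      mul_zero, Finset.sum_ite_eq]
    split_ifs <;> simp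
  have h1 := b.norm_le_of_repr_le (x := (∑ j ∈ F n, P j - B) g) (y := M ⟨B g, h⟩)
    (C := 1 / ((n : ℝ) + 1)) (by positivity) (fun j => by
      rw [hrepr, hM, norm_mul, Complex.norm_real]
      split_ifs with hj
      · rw [norm_zero]
        positivity
      · rw [norm_neg, one_div, inv_mul_eq_div, le_div_iff₀ hn, mul_comm]
        exact mul_le_mul_of_nonneg_right ((hF n j hj).trans (le_abs_self _)) (norm_nonneg _))
  have h2 := hMA ⟨B g, h⟩
  rw [hg] at h2
  calc _ ≤ _ := h1
    _ ≤ 1 / ((n : ℝ) + 1) * (C * ‖g‖) := by gcongr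
    _ = _ := by ring

variable {ι : Type u} {e : HilbertBasis ι ℂ H} {μ : ι → ℝ}

/-- Too many eigenvalues below `Λ` produce a vector of high frequency with small image. -/
theorem IsEigenfamily.le_of_card_lt (he : IsEigenfamily A e μ) (hA : IsSelfAdjoint A)
    (hμ : ∀ i, 0 ≤ μ i) {C : ℝ} (hC : 0 ≤ C)
    (hM : ∀ f j, b.repr (M f) j = w j * b.repr (f : H) j) (hMA : ∀ f, ‖M f‖ ≤ C * ‖A f‖)
    {R Λ : ℝ} (hR : 0 < R) (S : Finset ι) (F : Finset κ) (hcard : F.card < S.card)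
    (hS : ∀ i ∈ S, μ i ≤ Λ) (hF : ∀ j ∉ F, R ≤ w j) : R ≤ C * Λ := by
  -- For this `x`, `R‖x‖ ≤ ‖Mx‖ ≤ C‖Ax‖ ≤ CΛ‖x‖`: the first bound uses orthogonality to the modes in
  -- `F`, the last the expansion over `S`.
  obtain ⟨x, hx, hx0, hxS, hxF⟩ := e.exists_repr_eq_zero b S F hcard
  have hxA : x ∈ A.domain := by
    refine Submodule.span_le.mpr ?_ hx
    rintro _ ⟨i, -, rfl⟩
    exact (he i).1
  have hΛ : 0 ≤ Λ := by
    obtain ⟨i, hi⟩ := Finset.card_pos.mp (Nat.zero_lt_of_lt hcard)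
    exact (hμ i).trans (hS i hi)
  have h1 : ‖A ⟨x, hxA⟩‖ ≤ Λ * ‖x‖ := e.norm_le_of_repr_le hΛ fun i => by
    rw [he.repr_apply hA, norm_mul, Complex.norm_real, Real.norm_of_nonneg (hμ i)]
    by_cases hi : i ∈ S
    · exact mul_le_mul_of_nonneg_right (hS i hi) (norm_nonneg _)
    · simp [hxS i hi]
  have h2 : ‖x‖ ≤ R⁻¹ * ‖M ⟨x, hxA⟩‖ := b.norm_le_of_repr_le (inv_nonneg.mpr hR.le) fun j => by
    rw [hM, norm_mul, Complex.norm_real, inv_mul_eq_div, le_div_iff₀ hR, mul_comm]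
    by_cases hj : j ∈ F
    · simp [hxF j hj]
    · exact mul_le_mul_of_nonneg_right ((hF j hj).trans (le_abs_self _)) (norm_nonneg _)
  have h3 : ‖x‖ ≤ R⁻¹ * (C * (Λ * ‖x‖)) := by
    refine h2.trans ?_
    gcongr
    exact (hMA _).trans (by gcongr)
  rw [inv_mul_eq_div, le_div_iff₀ hR] at h3
  have hxpos : 0 < ‖x‖ := norm_pos_iff.mpr hx0
  nlinarith

/-- Too few eigenvalues below `Λ` produce a vector of low frequency with large image. -/
theorem IsEigenfamily.le_of_lt_card (he : IsEigenfamily A e μ) (hA : IsSelfAdjoint A)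
    (hbA : ∀ j, b j ∈ A.domain) (hw : ∀ j, 0 ≤ w j) {c : ℝ} (hc : 0 < c)
    (hM : ∀ f j, b.repr (M f) j = w j * b.repr (f : H) j) (hAM : ∀ f, c * ‖A f‖ ≤ ‖M f‖)
    {R Λ : ℝ} (hΛ : 0 < Λ) (S : Finset κ) (F : Finset ι) (hcard : F.card < S.card)
    (hS : ∀ j ∈ S, w j ≤ R) (hF : ∀ i ∉ F, Λ ≤ μ i) : c * Λ ≤ R := by
  -- The roles of the bases are exchanged: `cΛ‖x‖ ≤ c‖Ax‖ ≤ ‖Mx‖ ≤ R‖x‖`.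
  obtain ⟨x, hx, hx0, hxS, hxF⟩ := b.exists_repr_eq_zero e S F hcard
  have hxA : x ∈ A.domain := by
    refine Submodule.span_le.mpr ?_ hx
    rintro _ ⟨i, -, rfl⟩
    exact hbA i
  have hR : 0 ≤ R := by
    obtain ⟨i, hi⟩ := Finset.card_pos.mp (Nat.zero_lt_of_lt hcard)
    exact (hw i).trans (hS i hi)
  have h1 : ‖M ⟨x, hxA⟩‖ ≤ R * ‖x‖ := b.norm_le_of_repr_le hR fun j => by
    rw [hM, norm_mul, Complex.norm_real, Real.norm_of_nonneg (hw j)]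
    by_cases hj : j ∈ S
    · exact mul_le_mul_of_nonneg_right (hS j hj) (norm_nonneg _)
    · simp [hxS j hj]
  have h2 : ‖x‖ ≤ Λ⁻¹ * ‖A ⟨x, hxA⟩‖ := e.norm_le_of_repr_le (inv_nonneg.mpr hΛ.le) fun i => by
    rw [he.repr_apply hA, norm_mul, Complex.norm_real, inv_mul_eq_div, le_div_iff₀ hΛ, mul_comm]
    by_cases hi : i ∈ F
    · simp [hxF i hi]
    · exact mul_le_mul_of_nonneg_right ((hF i hi).trans (le_abs_self _)) (norm_nonneg _)
  rw [inv_mul_eq_div, le_div_iff₀ hΛ] at h2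
  have hxpos : 0 < ‖x‖ := norm_pos_iff.mpr hx0
  have h3 : c * (‖x‖ * Λ) ≤ R * ‖x‖ := by
    calc _ ≤ c * ‖A ⟨x, hxA⟩‖ := by gcongr
      _ ≤ _ := (hAM _).trans h1
  refine le_of_mul_le_mul_right ?_ hxpos
  linarith

omit [CompleteSpace H] in
theorem IsEigenfamily.one_le (he : IsEigenfamily A e μ)
    (hpos : ∀ f : A.domain, ‖(f : H)‖ ^ 2 ≤ (inner ℂ (f : H) (A f)).re) (i : ι) : 1 ≤ μ i := by
  obtain ⟨h, hi⟩ := he i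
  have := hpos ⟨e i, h⟩
  rw [hi, inner_smul_right, inner_self_eq_norm_sq_to_K] at this
  simpa [e.orthonormal.1 i] using this

/-- The multiplicity of an eigenvalue is the number of its occurrences in an eigenbasis. -/
theorem IsEigenfamily.encard_eq_rank (he : IsEigenfamily A e μ) (hA : IsSelfAdjoint A) (z : ℂ)
    (hfin : {i | (μ i : ℂ) = z}.Finite) :
    {i | (μ i : ℂ) = z}.encard = Cardinal.toENat (Module.rank ℂ (PerOp.eigenspace A z)) := by
  classical
  have := hfin.fintype
  have hmem : ∀ f : A.domain, f ∈ PerOp.eigenspace A z ↔ A f = z • (f : H) := fun f => by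
    rw [PerOp.eigenspace, LinearMap.mem_ker, LinearMap.sub_apply, sub_eq_zero]
    rfl
  choose hd hAe using he
  have he : IsEigenfamily A e μ := fun i => ⟨hd i, hAe i⟩
  let v : {i | (μ i : ℂ) = z} → PerOp.eigenspace A z := fun i =>
    ⟨⟨e i, hd i⟩, (hmem _).mpr (by rw [hAe, i.2])⟩
  let φ : PerOp.eigenspace A z →ₗ[ℂ] H := A.domain.subtype ∘ₗ (PerOp.eigenspace A z).subtype
  have hli : LinearIndependent ℂ v := by
    refine LinearIndependent.of_comp φ ?_
    exact e.orthonormal.linearIndependent.comp _ Subtype.val_injective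
  have hsp : ⊤ ≤ Submodule.span ℂ (Set.range v) := by
    rintro ⟨f, hf⟩ -
    -- Coefficients off the fibre vanish, so the expansion of an eigenvector is a finite sum and no
    -- closure of the span is needed.
    have hz : ∀ i, (μ i : ℂ) ≠ z → e.repr (f : H) i = 0 := fun i hi => by
      have h1 := he.repr_apply hA f i
      rw [(hmem f).mp hf, e.repr_apply_apply, inner_smul_right, ← e.repr_apply_apply] at h1
      have h2 : ((μ i : ℂ) - z) * e.repr (f : H) i = 0 := by rw [sub_mul, h1, sub_self]
      exact (mul_eq_zero.mp h2).resolve_left (sub_ne_zero.mpr hi)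
    let c : ι → ℂ := fun i => e.repr (f : H) i
    have hsum : (f : H) = ∑ i ∈ hfin.toFinset, c i • e i :=
      (e.hasSum_repr (f : H)).unique (hasSum_sum_of_ne_finset_zero fun i hi => by
        rw [hz i (by simpa using hi), zero_smul])
    have hsum' : (⟨f, hf⟩ : PerOp.eigenspace A z) = ∑ i : {i | (μ i : ℂ) = z}, c i • v i := by
      apply Subtype.ext
      apply Subtype.ext
      change (f : H) = φ _
      have hterm : ∀ i : {i | (μ i : ℂ) = z}, φ (c i • v i) = c i • e i :=
        fun i => φ.map_smul (c i) (v i)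
      rw [map_sum, Finset.sum_congr rfl fun i _ => hterm i]
      refine hsum.trans (Finset.sum_subtype _ (fun i => ?_) _)
      simp
    rw [hsum']
    exact Submodule.sum_mem _ fun i _ => Submodule.smul_mem _ _ (Submodule.subset_span ⟨i, rfl⟩)
  rw [rank_eq_card_basis (Module.Basis.mk hli hsp), Set.encard_eq_coe_toFinset_card,
    Set.toFinset_card]
  simp

end LinearPMap

end DiagonalComparison

/-! ### Enumeration of eigenvalues in increasing order -/

section EigenvalueList

universe u

/-- An infinite linear order with finite initial segments is isomorphic to `ℕ`. -/
theorem nonempty_orderIso_nat {ι : Type*} [LinearOrder ι] [Infinite ι]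
    (h : ∀ i : ι, (Set.Iic i).Finite) : Nonempty (ℕ ≃o ι) := by
  let : LocallyFiniteOrder ι :=
    LocallyFiniteOrder.ofFiniteIcc fun a b => (h b).subset fun _ hx => hx.2
  let : SuccOrder ι := LinearLocallyFiniteOrder.succOrder ι
  let : PredOrder ι := LinearLocallyFiniteOrder.predOrder ι
  have : NoMaxOrder ι := ⟨fun a => by
    by_contra! ha
    exact Set.infinite_univ ((h a).subset fun x _ => ha x)⟩
  obtain ⟨i₀⟩ : Nonempty ι := inferInstance
  obtain ⟨m, hm, hmin⟩ := Set.exists_min_image _ id (h i₀) ⟨i₀, le_rfl⟩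
  let : OrderBot ι :=
    { bot := m
      bot_le := fun a => by
        rcases le_total a i₀ with ha | ha
        · exact hmin a ha
        · exact le_trans hm ha }
  exact ⟨orderIsoNatOfLinearSuccPredArch.symm⟩

/-- A real family with finite sublevel sets can be enumerated in increasing order. -/
theorem exists_equiv_nat_monotone {ι : Type*} [Infinite ι] (μ : ι → ℝ)
    (hfin : ∀ Λ, {i | μ i ≤ Λ}.Finite) : ∃ σ : ℕ ≃ ι, Monotone (μ ∘ σ) := by
  classical
  let : LinearOrder ι := linearOrderOfSTO WellOrderingRel
  -- Ties between equal values are broken by an arbitrary linear order on the indices.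
  let g : ι → ℝ ×ₗ ι := fun i => toLex (μ i, i)
  have hg : Function.Injective g := fun i j h => congrArg (fun p => (ofLex p).2) h
  have hgμ : ∀ i j, g i ≤ g j → μ i ≤ μ j := fun i j h => by
    rcases (Prod.Lex.le_iff).mp h with h | h
    · exact h.le
    · exact h.1.le
  have : Infinite (Set.range g) := (Set.infinite_range_of_injective hg).to_subtype
  obtain ⟨φ⟩ := nonempty_orderIso_nat (ι := Set.range g) (by
    rintro ⟨_, j, rfl⟩
    refine Set.Finite.of_finite_image (f := Subtype.val) ?_ Subtype.val_injective.injOn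
    refine ((hfin (μ j)).image g).subset ?_
    rintro _ ⟨⟨_, i, rfl⟩, hi, rfl⟩
    exact ⟨i, hgμ i j hi, rfl⟩)
  refine ⟨φ.toEquiv.trans (Equiv.ofInjective g hg).symm, fun m n hmn => hgμ _ _ ?_⟩
  have hval : ∀ n, g ((Equiv.ofInjective g hg).symm (φ n)) = φ n := fun n =>
    Equiv.apply_ofInjective_symm hg (φ n)
  simp only [Equiv.trans_apply, RelIso.coe_fn_toEquiv]
  rw [hval, hval]
  exact φ.monotone hmn

/-- Real families with equally many occurrences of each value agree up to reindexing. -/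
theorem exists_equiv_of_encard_fiber_eq {α β : Type*} (f : α → ℝ) (g : β → ℝ)
    (hfin : ∀ z, {b | g b = z}.Finite) (h : ∀ z, {a | f a = z}.encard = {b | g b = z}.encard) :
    ∃ σ : α ≃ β, ∀ a, g (σ a) = f a := by
  have hE : ∀ z, Nonempty ({a // f a = z} ≃ {b // g b = z}) := fun z => by
    -- Finiteness matters: infinite sets of equal `encard` need not be equinumerous.
    have hfin' : {a | f a = z}.Finite := by
      rw [← Set.encard_lt_top_iff, h]
      exact (hfin z).encard_lt_top
    have : Finite {b // g b = z} := (hfin z).to_subtype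
    have : Finite {a // f a = z} := hfin'.to_subtype
    refine Finite.card_eq.mp ?_
    have h1 := h z
    rw [← hfin'.cast_ncard_eq, ← (hfin z).cast_ncard_eq] at h1
    exact_mod_cast h1
  refine ⟨Equiv.ofFiberEquiv fun z => (hE z).some, fun a => Equiv.ofFiberEquiv_map _ a⟩

variable {H : Type u} [NormedAddCommGroup H] [InnerProductSpace ℂ H] [CompleteSpace H]
  {A : H →ₗ.[ℂ] H} {ι : Type u} {e : HilbertBasis ι ℂ H} {μ : ι → ℝ}

namespace LinearPMap

theorem IsEigenfamily.finite_fiber (hfin : ∀ Λ, {i | μ i ≤ Λ}.Finite) (z : ℂ) :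
    {i | (μ i : ℂ) = z}.Finite :=
  (hfin z.re).subset fun i (hi : (μ i : ℂ) = z) => by simp [← hi]

theorem IsEigenfamily.exists_isEigenvalueList [Infinite ι] (he : IsEigenfamily A e μ)
    (hA : IsSelfAdjoint A) (hfin : ∀ Λ, {i | μ i ≤ Λ}.Finite) :
    ∃ lam : ℕ+ → ℝ, PerOp.IsEigenvalueList A lam := by
  obtain ⟨σ, hσ⟩ := exists_equiv_nat_monotone μ hfin
  let τ : ℕ+ ≃ ι := Equiv.pnatEquivNat.trans σ
  refine ⟨μ ∘ τ, fun m n hmn => hσ ?_, fun z => ?_⟩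
  · exact Nat.pred_le_pred hmn
  · rw [← he.encard_eq_rank hA z (IsEigenfamily.finite_fiber hfin z)]
    exact Set.encard_congr (τ.subtypeEquiv fun _ => Iff.rfl)

/-- Both families have fibres counted by the dimensions of the eigenspaces, which transfers
estimates from the eigenbasis to any list. -/
theorem IsEigenfamily.exists_equiv (he : IsEigenfamily A e μ)
    (hA : IsSelfAdjoint A) (hfin : ∀ Λ, {i | μ i ≤ Λ}.Finite) {lam : ℕ+ → ℝ}
    (hlam : PerOp.IsEigenvalueList A lam) : ∃ σ : ℕ+ ≃ ι, ∀ n, μ (σ n) = lam n := by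
  refine exists_equiv_of_encard_fiber_eq lam μ (fun z => ?_) (fun z => ?_)
  · simpa using IsEigenfamily.finite_fiber hfin (z : ℂ)
  · have h := hlam.multiplicity z
    rw [← he.encard_eq_rank hA z (IsEigenfamily.finite_fiber hfin z)] at h
    simpa using h

end LinearPMap

end EigenvalueList

/-! ### Vector valued Fourier modes and derivatives -/

noncomputable section

namespace PerOp

section Modes

variable {K : ℕ}

/-- The vector valued Fourier mode `e^{ikx}` in the `i`-th component. -/
def mode (p : Fin K × ℤ) : L2perK K :=
  WithLp.toLp 2 (Pi.single p.1 (fourierBasis p.2 : L2per))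

theorem inner_mode (p : Fin K × ℤ) (f : L2perK K) :
    inner ℂ (mode p) f = fourierCoeff (f p.1) p.2 := by
  rw [PiLp.inner_apply, Finset.sum_eq_single p.1]
  · rw [← fourierBasis_repr, HilbertBasis.repr_apply_apply]
    simp [mode]
  · intro i _ hi
    simp [mode, hi]
  · simp

theorem fourierCoeff_eq_zero_iff {f : L2per} : (∀ n, fourierCoeff f n = 0) ↔ f = 0 := by
  constructor
  · intro h
    apply fourierBasis.repr.injective
    ext n
    rw [fourierBasis_repr, h, map_zero]
    rfl
  · rintro rfl n
    rw [← fourierBasis_repr, map_zero]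
    rfl

theorem orthonormal_mode : Orthonormal ℂ (mode (K := K)) := by
  classical
  rw [orthonormal_iff_ite]
  rintro ⟨i, k⟩ ⟨j, l⟩
  rw [inner_mode]
  have h : fourierCoeff (fourierBasis l : L2per) k = if k = l then 1 else 0 := by
    rw [← fourierBasis_repr, HilbertBasis.repr_apply_apply]
    exact orthonormal_iff_ite.mp fourierBasis.orthonormal k l
  by_cases hij : i = j
  · subst hij
    simpa [mode] using h
  · have h0 : fourierCoeff (0 : L2per) k = 0 := fourierCoeff_eq_zero_iff.mpr rfl k
    simpa [mode, hij] using h0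

/-- The Fourier basis of the vector valued periodic functions. -/
def modeBasis (K : ℕ) : HilbertBasis (Fin K × ℤ) ℂ (L2perK K) :=
  HilbertBasis.mkOfOrthogonalEqBot orthonormal_mode (by
    rw [Submodule.eq_bot_iff]
    intro f hf
    ext1 i
    refine fourierCoeff_eq_zero_iff.mp fun n => ?_
    rw [← inner_mode (i, n)]
    exact (Submodule.mem_orthogonal _ _).mp hf _ (Submodule.subset_span ⟨(i, n), rfl⟩))

theorem modeBasis_apply (p : Fin K × ℤ) : modeBasis K p = mode p := by
  rw [modeBasis, HilbertBasis.coe_mkOfOrthogonalEqBot]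

theorem modeBasis_repr (f : L2perK K) (p : Fin K × ℤ) :
    (modeBasis K).repr f p = fourierCoeff (f p.1) p.2 := by
  rw [HilbertBasis.repr_apply_apply, modeBasis_apply, inner_mode]

theorem modeBasis_repr_derivOpK (j : ℕ) (f : (derivOpK K j).domain) (p : Fin K × ℤ) :
    (modeBasis K).repr (derivOpK K j f) p =
      (Complex.I * p.2) ^ j * (modeBasis K).repr (f : L2perK K) p := by
  rw [modeBasis_repr, modeBasis_repr, ← fourierBasis_repr]
  change fourierBasis.repr (fourierBasis.repr.symm _) p.2 = _
  rw [LinearIsometryEquiv.apply_symm_apply]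

theorem modeBasis_repr_negD2AddOne (f : (derivOpK K 2).domain) (p : Fin K × ℤ) :
    (modeBasis K).repr (negD2AddOne K f) p =
      ((1 + (p.2 : ℝ) ^ 2 : ℝ) : ℂ) * (modeBasis K).repr (f : L2perK K) p := by
  have h : negD2AddOne K f = -(derivOpK K 2 f) + (f : L2perK K) := rfl
  have h2 := modeBasis_repr_derivOpK 2 f p
  rw [HilbertBasis.repr_apply_apply] at h2
  rw [h, HilbertBasis.repr_apply_apply, inner_add_right, inner_neg_right, h2,
    ← HilbertBasis.repr_apply_apply, mul_pow, Complex.I_sq]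
  push_cast
  ring

theorem mode_mem_domain (j : ℕ) (p : Fin K × ℤ) : mode p ∈ (derivOpK K j).domain := by
  classical
  intro i
  change Memℓp (fun n : ℤ => (Complex.I * n) ^ j * fourierCoeff (mode p i) n) 2
  -- The coefficient sequence is supported at the single frequency `p.2`.
  refine Memℓp.of_exponent_ge (memℓp_zero ?_) zero_le
  refine (Set.finite_singleton p.2).subset fun n hn => ?_
  by_contra hne
  apply hn
  have h : fourierCoeff (mode p i) n = inner ℂ (mode (i, n)) (mode p) := (inner_mode (i, n) _).symm
  rw [h, orthonormal_mode.2 (fun h => hne (Set.mem_singleton_iff.mpr (congrArg Prod.snd h))), mul_zero]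

theorem norm_derivOpK_two_le (f : (derivOpK K 2).domain) :
    ‖derivOpK K 2 f‖ ≤ ‖negD2AddOne K f‖ := by
  rw [← one_mul ‖negD2AddOne K f‖]
  refine (modeBasis K).norm_le_of_repr_le zero_le_one fun p => ?_
  rw [modeBasis_repr_derivOpK, modeBasis_repr_negD2AddOne, norm_mul, norm_mul, one_mul]
  refine mul_le_mul_of_nonneg_right ?_ (norm_nonneg _)
  rw [Complex.norm_real, Real.norm_of_nonneg (by positivity)]
  simp

theorem norm_le_norm_negD2AddOne (f : (derivOpK K 2).domain) :
    ‖(f : L2perK K)‖ ≤ ‖negD2AddOne K f‖ := by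
  rw [← one_mul ‖negD2AddOne K f‖]
  refine (modeBasis K).norm_le_of_repr_le zero_le_one fun p => ?_
  rw [modeBasis_repr_negD2AddOne, norm_mul, one_mul]
  refine le_mul_of_one_le_left (norm_nonneg _) ?_
  rw [Complex.norm_real, Real.norm_of_nonneg (by positivity)]
  nlinarith [sq_nonneg (p.2 : ℝ)]

/-- The interpolation inequality between a function and its second derivative. -/
theorem norm_derivOpK_one_le {ε : ℝ} (hε : 0 < ε) (f : (derivOpK K 2).domain) :
    ‖derivOpK K 1 ⟨f, derivOpK_domain_two_le_one K f.2⟩‖ ≤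
      ε * ‖derivOpK K 2 f‖ + ε⁻¹ * ‖(f : L2perK K)‖ := by
  -- The comparison vector `-εD²f + ε⁻¹f` has Fourier multiplier `εk² + ε⁻¹`, which dominates `2|k|`
  -- by completing the square.
  have h : ‖derivOpK K 1 ⟨f, derivOpK_domain_two_le_one K f.2⟩‖ ≤
      1 * ‖-((ε : ℂ) • derivOpK K 2 f) + ((ε⁻¹ : ℝ) : ℂ) • (f : L2perK K)‖ := by
    refine (modeBasis K).norm_le_of_repr_le zero_le_one fun p => ?_
    have h2 := modeBasis_repr_derivOpK 2 f p
    rw [HilbertBasis.repr_apply_apply] at h2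
    rw [modeBasis_repr_derivOpK, HilbertBasis.repr_apply_apply, HilbertBasis.repr_apply_apply,
      inner_add_right, inner_neg_right, inner_smul_right, inner_smul_right, h2,
      HilbertBasis.repr_apply_apply, one_mul]
    have h3 : -((ε : ℂ) * ((Complex.I * p.2) ^ 2 * inner ℂ (modeBasis K p) (f : L2perK K))) +
        ((ε⁻¹ : ℝ) : ℂ) * inner ℂ (modeBasis K p) (f : L2perK K) =
        ((ε * (p.2 : ℝ) ^ 2 + ε⁻¹ : ℝ) : ℂ) * inner ℂ (modeBasis K p) (f : L2perK K) := by
      rw [mul_pow, Complex.I_sq]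
      push_cast
      ring
    rw [h3, norm_mul, norm_mul, Complex.norm_real, Real.norm_of_nonneg (by positivity)]
    refine mul_le_mul_of_nonneg_right ?_ (norm_nonneg _)
    rw [pow_one, norm_mul, Complex.norm_I, one_mul, Complex.norm_intCast]
    have h4 : ε * ε⁻¹ = 1 := mul_inv_cancel₀ hε.ne'
    have h5 : 0 < ε⁻¹ := inv_pos.mpr hε
    have h6 : 0 ≤ ε * (|(p.2 : ℝ)| - ε⁻¹) ^ 2 := by positivity
    have h7 := abs_nonneg (p.2 : ℝ)
    rw [← sq_abs]
    have h8 : ε * (|(p.2 : ℝ)| - ε⁻¹) ^ 2 = ε * |(p.2 : ℝ)| ^ 2 - 2 * (ε * ε⁻¹) * |(p.2 : ℝ)| +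
      (ε * ε⁻¹) * ε⁻¹ := by ring
    rw [h8, h4] at h6
    linarith
  rw [one_mul] at h
  refine h.trans ((norm_add_le _ _).trans ?_)
  rw [norm_neg, norm_smul, norm_smul, Complex.norm_real, Complex.norm_real,
    Real.norm_of_nonneg hε.le, Real.norm_of_nonneg (inv_nonneg.mpr hε.le)]

theorem norm_derivOpK_one_le_negD2AddOne (f : (derivOpK K 2).domain) :
    ‖derivOpK K 1 ⟨f, derivOpK_domain_two_le_one K f.2⟩‖ ≤ 2 * ‖negD2AddOne K f‖ := by
  have h := norm_derivOpK_one_le one_pos f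
  rw [inv_one, one_mul, one_mul] at h
  linarith [norm_derivOpK_two_le f, norm_le_norm_negD2AddOne f]

end Modes

/-! ### Multiplication operators -/

section Multiplication

variable {K : ℕ}

theorem coeFn_mulOp (a : C(Circ, ℂ)) (f : L2per) :
    mulOp a f =ᵐ[AddCircle.haarAddCircle] fun x => a x * f x :=
  MemLp.coeFn_toLp (memLp_mul a f)

theorem norm_mulOp_le (a : C(Circ, ℂ)) (f : L2per) : ‖mulOp a f‖ ≤ ‖a‖ * ‖f‖ := by
  refine Lp.norm_le_mul_norm_of_ae_le_mul ?_
  filter_upwards [coeFn_mulOp a f] with x hx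
  rw [hx, norm_mul]
  exact mul_le_mul_of_nonneg_right (a.norm_coe_le_norm x) (norm_nonneg _)

theorem exists_norm_matMulOp_le (A : Matrix (Fin K) (Fin K) C(Circ, ℂ)) :
    ∃ C, 0 ≤ C ∧ ∀ f, ‖matMulOp A f‖ ≤ C * ‖f‖ := by
  have hc : Continuous (matMulOp A) := by
    refine (PiLp.continuous_toLp 2 _).comp (continuous_pi fun i => ?_)
    refine continuous_finsetSum _ fun j _ => ?_
    have h1 : Continuous (mulOp (A i j)) :=
      ((mulOp (A i j)).mkContinuous _ (norm_mulOp_le (A i j))).continuous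
    exact h1.comp (PiLp.continuous_apply 2 _ j)
  let T : L2perK K →L[ℂ] L2perK K := ⟨matMulOp A, hc⟩
  exact ⟨‖T‖, norm_nonneg _, fun f => T.le_opNorm f⟩

end Multiplication

end PerOp

end

/-! ### Ellipticity and the norm equivalence -/

noncomputable section

namespace PerOp

variable {T : ℝ} {K : ℕ}

theorem coeFn_sum_mulOp (a : Fin K → C(Circ, ℂ)) (g : L2perK K) :
    (∑ j, mulOp (a j) (g j) : L2per) =ᵐ[AddCircle.haarAddCircle] fun x => ∑ j, a j x * g j x := by
  classical
  have h : ∀ s : Finset (Fin K), (∑ j ∈ s, mulOp (a j) (g j) : L2per)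
      =ᵐ[AddCircle.haarAddCircle] fun x => ∑ j ∈ s, a j x * g j x := fun s => by
    induction s using Finset.induction_on with
    | empty =>
      simp only [Finset.sum_empty]
      exact Lp.coeFn_zero _ _ _
    | insert j s hj ih =>
      rw [Finset.sum_insert hj]
      filter_upwards [Lp.coeFn_add (mulOp (a j) (g j)) (∑ j ∈ s, mulOp (a j) (g j)), ih,
        coeFn_mulOp (a j) (g j)] with x h1 h2 h3
      rw [h1, Pi.add_apply, h2, h3, Finset.sum_insert hj]
  exact h _

theorem integrable_sum_inner (u v : L2perK K) :
    Integrable (fun x => ∑ i, inner ℂ (u i x) (v i x)) (AddCircle.haarAddCircle : Measure Circ) :=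
  integrable_finsetSum _ fun i _ => L2.integrable_inner (u i) (v i)

theorem inner_eq_integral_sum (u v : L2perK K) :
    inner ℂ u v = ∫ x : Circ, ∑ i, inner ℂ (u i x) (v i x) ∂AddCircle.haarAddCircle := by
  rw [PiLp.inner_apply, integral_finsetSum _ fun i _ => L2.integrable_inner (u i) (v i)]
  rfl

theorem re_inner_eq_integral_sum (u v : L2perK K) :
    (inner ℂ u v).re =
      ∫ x : Circ, (∑ i, inner ℂ (u i x) (v i x)).re ∂AddCircle.haarAddCircle := by
  rw [inner_eq_integral_sum]
  exact (integral_re (integrable_sum_inner u v)).symm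

namespace RegularOperator

variable (L : RegularOperator T K)

theorem ellipticity_circle {C₀ : ℝ}
    (hell : ∀ x ∈ Set.Icc (0 : ℝ) (2 * Real.pi), ∀ V : EuclideanSpace ℂ (Fin K),
      C₀ * ‖V‖ ^ 2 ≤ (dotProduct (star V.ofLp) ((L.P₂ (x : ℂ)).mulVec V.ofLp)).re)
    (x : Circ) (V : Fin K → ℂ) :
    C₀ * (∑ i, inner ℂ (V i) (V i)).re ≤ (∑ i, inner ℂ (V i) (∑ j, L.P₂c i j x * V j)).re := by
  obtain ⟨t, ht, rfl⟩ : ∃ t ∈ Set.Icc (0 : ℝ) (2 * Real.pi), (t : Circ) = x := by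
    have h := AddCircle.coe_image_Icc_eq (2 * Real.pi) 0
    rw [zero_add] at h
    have hx : x ∈ ((↑) : ℝ → Circ) '' Set.Icc 0 (2 * Real.pi) := h ▸ Set.mem_univ x
    exact hx
  have h := hell t ht (WithLp.toLp 2 V)
  have h1 : ‖(WithLp.toLp 2 V : EuclideanSpace ℂ (Fin K))‖ ^ 2 =
      (∑ i, inner ℂ (V i) (V i)).re := by
    rw [EuclideanSpace.norm_sq_eq, Complex.re_sum]
    refine Finset.sum_congr rfl fun i _ => ?_
    rw [inner_self_eq_norm_sq_to_K]
    norm_cast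
  rw [h1] at h
  refine h.trans_eq ?_
  congr 1
  refine Finset.sum_congr rfl fun i _ => ?_
  rw [RCLike.inner_apply, mul_comm]
  rfl

/-- The pointwise ellipticity, applied to the values of `g` at almost every point, is integrated
over the circle. -/
theorem re_inner_matMulOp_ge {C₀ : ℝ}
    (hell : ∀ x ∈ Set.Icc (0 : ℝ) (2 * Real.pi), ∀ V : EuclideanSpace ℂ (Fin K),
      C₀ * ‖V‖ ^ 2 ≤ (dotProduct (star V.ofLp) ((L.P₂ (x : ℂ)).mulVec V.ofLp)).re)
    (g : L2perK K) : C₀ * ‖g‖ ^ 2 ≤ (inner ℂ g (matMulOp L.P₂c g)).re := by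
  have h1 : ‖g‖ ^ 2 = (inner ℂ g g).re := (inner_self_eq_norm_sq (𝕜 := ℂ) g).symm
  rw [h1, re_inner_eq_integral_sum, re_inner_eq_integral_sum, ← integral_const_mul]
  refine integral_mono_ae ((integrable_sum_inner g g).re.const_mul _)
    (integrable_sum_inner g _).re ?_
  have h2 : ∀ᵐ x ∂(AddCircle.haarAddCircle : Measure Circ), ∀ i,
      (matMulOp L.P₂c g) i x = ∑ j, L.P₂c i j x * g j x :=
    ae_all_iff.mpr fun i => coeFn_sum_mulOp (L.P₂c i) g
  filter_upwards [h2] with x hx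
  simp only [hx]
  exact L.ellipticity_circle hell x fun i => g i x

/-- Coercivity and Cauchy–Schwarz. It is applied with `g = D²f`. -/
theorem norm_matMulOp_ge {C₀ : ℝ}
    (hell : ∀ x ∈ Set.Icc (0 : ℝ) (2 * Real.pi), ∀ V : EuclideanSpace ℂ (Fin K),
      C₀ * ‖V‖ ^ 2 ≤ (dotProduct (star V.ofLp) ((L.P₂ (x : ℂ)).mulVec V.ofLp)).re)
    (g : L2perK K) : C₀ * ‖g‖ ≤ ‖matMulOp L.P₂c g‖ := by
  have h := (L.re_inner_matMulOp_ge hell g).trans (re_inner_le_norm (𝕜 := ℂ) _ _)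
  rcases (norm_nonneg g).eq_or_lt with h0 | h0
  · rw [← h0, mul_zero]
    exact norm_nonneg _
  · refine le_of_mul_le_mul_left ?_ h0
    linarith

theorem op_apply (f : (derivOpK K 2).domain) :
    L.op f = -(matMulOp L.P₂c (derivOpK K 2 f)) +
      matMulOp (L.P₁c - L.dP₂c) (derivOpK K 1 ⟨f, derivOpK_domain_two_le_one K f.2⟩) +
      matMulOp L.P₀c f := rfl

theorem exists_norm_op_le :
    ∃ C, 0 < C ∧ ∀ f : (derivOpK K 2).domain, ‖L.op f‖ ≤ C * ‖negD2AddOne K f‖ := by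
  obtain ⟨c₂, hc₂, h₂⟩ := exists_norm_matMulOp_le L.P₂c
  obtain ⟨c₁, hc₁, h₁⟩ := exists_norm_matMulOp_le (L.P₁c - L.dP₂c)
  obtain ⟨c₀, hc₀, h₀⟩ := exists_norm_matMulOp_le L.P₀c
  refine ⟨c₂ + c₁ * 2 + c₀ + 1, by positivity, fun f => ?_⟩
  rw [op_apply]
  refine (norm_add₃_le).trans ?_
  rw [norm_neg]
  have e₂ := (h₂ (derivOpK K 2 f)).trans
    (mul_le_mul_of_nonneg_left (norm_derivOpK_two_le f) hc₂)
  have e₁ := (h₁ (derivOpK K 1 ⟨f, derivOpK_domain_two_le_one K f.2⟩)).trans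
    (mul_le_mul_of_nonneg_left (norm_derivOpK_one_le_negD2AddOne f) hc₁)
  have e₀ := (h₀ f).trans (mul_le_mul_of_nonneg_left (norm_le_norm_negD2AddOne f) hc₀)
  linarith [norm_nonneg (negD2AddOne K f)]

/-- The elliptic a priori estimate: the equation is solved for `P₂D²f`, the `Df` term is split by
interpolation, and `‖f‖ ≤ ‖Lf‖` closes the bound. -/
theorem exists_norm_negD2AddOne_le
    (hpos : ∀ f : L.op.domain,
      ‖(f : L2perK K)‖ ^ 2 ≤ (inner ℂ (f : L2perK K) (L.op f)).re)
    {C₀ : ℝ} (hC₀ : 0 < C₀)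
    (hell : ∀ x ∈ Set.Icc (0 : ℝ) (2 * Real.pi), ∀ V : EuclideanSpace ℂ (Fin K),
      C₀ * ‖V‖ ^ 2 ≤ (dotProduct (star V.ofLp) ((L.P₂ (x : ℂ)).mulVec V.ofLp)).re) :
    ∃ C, 0 < C ∧ ∀ f : (derivOpK K 2).domain, ‖negD2AddOne K f‖ ≤ C * ‖L.op f‖ := by
  obtain ⟨c₁, hc₁, h₁⟩ := exists_norm_matMulOp_le (L.P₁c - L.dP₂c)
  obtain ⟨c₀, hc₀, h₀⟩ := exists_norm_matMulOp_le L.P₀c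
  -- `ε` is chosen so that the first order term is absorbed by half of the second order term.
  set ε : ℝ := C₀ / (2 * (c₁ + 1)) with hε
  have hεpos : 0 < ε := by positivity
  have hεC : c₁ * ε ≤ C₀ / 2 := by
    rw [hε, ← mul_div_assoc, div_le_div_iff₀ (by positivity) (by positivity)]
    nlinarith
  -- The first summand bounds `D²f`, with the factor 2 paying for the absorption; the final 1
  -- accounts for `f` itself.
  refine ⟨2 / C₀ * (1 + c₁ * ε⁻¹ + c₀) + 1, by positivity, fun f => ?_⟩
  have hf : ‖(f : L2perK K)‖ ≤ ‖L.op f‖ := LinearPMap.norm_le_norm_apply (A := L.op) hpos f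
  set D1 := derivOpK K 1 ⟨f, derivOpK_domain_two_le_one K f.2⟩
  set D2 := derivOpK K 2 f
  have h2 : matMulOp L.P₂c D2 = -L.op f + matMulOp (L.P₁c - L.dP₂c) D1 + matMulOp L.P₀c f := by
    rw [op_apply]
    abel
  have h3 : C₀ * ‖D2‖ ≤ ‖L.op f‖ + c₁ * ‖D1‖ + c₀ * ‖(f : L2perK K)‖ := by
    refine (L.norm_matMulOp_ge hell D2).trans ?_
    rw [h2]
    refine norm_add₃_le.trans ?_
    rw [norm_neg]
    gcongr
    · exact h₁ _
    · exact h₀ _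
  have h4 : c₁ * ‖D1‖ ≤ c₁ * ε * ‖D2‖ + c₁ * ε⁻¹ * ‖(f : L2perK K)‖ := by
    have := mul_le_mul_of_nonneg_left (norm_derivOpK_one_le hεpos f) hc₁
    linarith
  have h5 : c₁ * ε * ‖D2‖ ≤ C₀ / 2 * ‖D2‖ := mul_le_mul_of_nonneg_right hεC (norm_nonneg _)
  have h6 : (c₁ * ε⁻¹ + c₀) * ‖(f : L2perK K)‖ ≤ (c₁ * ε⁻¹ + c₀) * ‖L.op f‖ :=
    mul_le_mul_of_nonneg_left hf (by positivity)
  have h7 : C₀ / 2 * ‖D2‖ ≤ (1 + c₁ * ε⁻¹ + c₀) * ‖L.op f‖ := by linarith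
  have h8 : ‖D2‖ ≤ 2 / C₀ * ((1 + c₁ * ε⁻¹ + c₀) * ‖L.op f‖) := by
    rw [div_mul_eq_mul_div, le_div_iff₀ hC₀]
    linarith
  have h9 : negD2AddOne K f = -D2 + (f : L2perK K) := rfl
  rw [h9]
  refine (norm_add_le _ _).trans ?_
  rw [norm_neg]
  linarith

end RegularOperator

end PerOp

end

/-! ### Counting modes and the growth of the eigenvalues -/

namespace PerOp

/-- The modes of frequency at most `m`. -/
noncomputable def lowModes (K m : ℕ) : Finset (Fin K × ℤ) :=
  Finset.univ ×ˢ Finset.Icc (-(m : ℤ)) m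

theorem card_lowModes (K m : ℕ) : (lowModes K m).card = K * (2 * m + 1) := by
  rw [lowModes, Finset.card_product, Finset.card_univ, Fintype.card_fin, Int.card_Icc]
  congr 1
  omega

theorem mem_lowModes {K m : ℕ} {p : Fin K × ℤ} : p ∈ lowModes K m ↔ |p.2| ≤ m := by
  simp [lowModes, abs_le]

theorem weight_le_of_mem_lowModes {K m : ℕ} {p : Fin K × ℤ} (hp : p ∈ lowModes K m) :
    1 + (p.2 : ℝ) ^ 2 ≤ 1 + (m : ℝ) ^ 2 := by
  have h : |(p.2 : ℝ)| ≤ m := by exact_mod_cast mem_lowModes.mp hp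
  rw [← sq_abs (p.2 : ℝ)]
  gcongr

/-- Integrality gives `|k| ≥ m + 1`, so the lower bound on the weight is positive even for `m = 0`.
-/
theorem le_weight_of_notMem_lowModes {K m : ℕ} {p : Fin K × ℤ} (hp : p ∉ lowModes K m) :
    ((m : ℝ) + 1) ^ 2 ≤ 1 + (p.2 : ℝ) ^ 2 := by
  rw [mem_lowModes, not_le] at hp
  have h : (m : ℝ) + 1 ≤ |(p.2 : ℝ)| := by exact_mod_cast hp
  rw [← sq_abs (p.2 : ℝ)]
  nlinarith

end PerOp

theorem lemma4p2 {T : ℝ} {K : ℕ} (hK : 0 < K) (L : PerOp.RegularOperator T K)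
    (hsa : IsSelfAdjoint L.op)
    (hpos : ∀ f : L.op.domain,
      ‖(f : PerOp.L2perK K)‖ ^ 2 ≤ (inner ℂ (f : PerOp.L2perK K) (L.op f)).re)
    (C₀ : ℝ) (hC₀ : 0 < C₀)
    (hell : ∀ x ∈ Set.Icc (0 : ℝ) (2 * Real.pi), ∀ V : EuclideanSpace ℂ (Fin K),
      C₀ * ‖V‖ ^ 2 ≤ (dotProduct (star V.ofLp) ((L.P₂ (x : ℂ)).mulVec V.ofLp)).re) :
    (∃ α₁ α₂ : ℝ, 0 < α₁ ∧ 0 < α₂ ∧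
      ∀ (f : PerOp.L2perK K) (hf : f ∈ (PerOp.derivOpK K 2).domain),
        α₁ * ‖L.op ⟨f, hf⟩‖ ≤ ‖PerOp.negD2AddOne K ⟨f, hf⟩‖ ∧
          ‖PerOp.negD2AddOne K ⟨f, hf⟩‖ ≤ α₂ * ‖L.op ⟨f, hf⟩‖) ∧
    (∃ lam : ℕ+ → ℝ, PerOp.IsEigenvalueList L.op lam) ∧
    (∀ lam : ℕ+ → ℝ, PerOp.IsEigenvalueList L.op lam →
      ∃ β₁ β₂ : ℝ, 0 < β₁ ∧ 0 < β₂ ∧ ∃ N : ℕ+, ∀ n : ℕ+, N ≤ n →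
        β₁ ^ 2 * (n : ℝ) ^ 2 ≤ lam n ∧ lam n ≤ β₂ ^ 2 * (n : ℝ) ^ 2) := by
  classical
  obtain ⟨C₁, hC₁, h₁⟩ := L.exists_norm_op_le
  obtain ⟨C₂, hC₂, h₂⟩ := L.exists_norm_negD2AddOne_le hpos hC₀ hell
  have h₁' : ∀ f : (PerOp.derivOpK K 2).domain,
      C₁⁻¹ * ‖L.op f‖ ≤ ‖PerOp.negD2AddOne K f‖ := fun f => by
    rw [inv_mul_le_iff₀ hC₁]
    exact h₁ f
  refine ⟨⟨C₁⁻¹, C₂, inv_pos.mpr hC₁, hC₂, fun f hf => ⟨h₁' ⟨f, hf⟩, h₂ ⟨f, hf⟩⟩⟩, ?_⟩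
  let w : Fin K × ℤ → ℝ := fun p => 1 + (p.2 : ℝ) ^ 2
  let M : L.op.domain → PerOp.L2perK K := fun f => PerOp.negD2AddOne K f
  have hM : ∀ f p, (PerOp.modeBasis K).repr (M f) p =
      w p * (PerOp.modeBasis K).repr (f : PerOp.L2perK K) p := PerOp.modeBasis_repr_negD2AddOne
  have hw0 : ∀ p, 0 ≤ w p := fun p => by positivity
  have hb : ∀ p, PerOp.modeBasis K p ∈ L.op.domain := fun p => by
    rw [PerOp.modeBasis_apply]
    exact PerOp.mode_mem_domain 2 p
  have hlow : ∀ R : ℝ, ∃ m : ℕ, R ≤ ((m : ℝ) + 1) ^ 2 := fun R => by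
    obtain ⟨m, hm⟩ := exists_nat_ge R
    exact ⟨m, by nlinarith⟩
  obtain ⟨B, hB⟩ := LinearPMap.exists_inverse hsa hpos
  have hBc : IsCompactOperator B :=
    LinearPMap.isCompactOperator_inverse_of_diagonal hC₂.le hM h₂ (fun R => by
      obtain ⟨m, hm⟩ := hlow R
      exact ⟨PerOp.lowModes K m, fun p hp =>
        hm.trans (PerOp.le_weight_of_notMem_lowModes hp)⟩) B hB
  obtain ⟨ι, e, μ, he⟩ := LinearPMap.exists_eigenbasis hsa B hBc hB
  have hμ1 : ∀ i, 1 ≤ μ i := he.one_le hpos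
  have hμ0 : ∀ i, 0 ≤ μ i := fun i => zero_le_one.trans (hμ1 i)
  have lower : ∀ (m : ℕ) (Λ : ℝ) (S : Finset ι), K * (2 * m + 1) < S.card →
      (∀ i ∈ S, μ i ≤ Λ) → ((m : ℝ) + 1) ^ 2 ≤ C₂ * Λ := fun m Λ S hcard hS =>
    he.le_of_card_lt hsa hμ0 hC₂.le hM h₂ (by positivity) S (PerOp.lowModes K m)
      (by rwa [PerOp.card_lowModes]) hS (fun p hp => PerOp.le_weight_of_notMem_lowModes hp)
  have upper : ∀ (m : ℕ) (Λ : ℝ) (F : Finset ι), 0 < Λ → F.card < K * (2 * m + 1) →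
      (∀ i ∉ F, Λ ≤ μ i) → C₁⁻¹ * Λ ≤ 1 + (m : ℝ) ^ 2 := fun m Λ F hΛ hcard hF =>
    he.le_of_lt_card hsa hb hw0 (inv_pos.mpr hC₁) hM h₁' hΛ (PerOp.lowModes K m) F
      (by rwa [PerOp.card_lowModes]) (fun p hp => PerOp.weight_le_of_mem_lowModes hp) hF
  have hfin : ∀ Λ, {i | μ i ≤ Λ}.Finite := fun Λ => by
    by_contra hinf
    -- The extra 1 makes `(m + 1)²` exceed `C₂Λ`, contradicting `lower`.
    obtain ⟨m, hm⟩ := hlow (C₂ * Λ + 1)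
    obtain ⟨S, hS, hScard⟩ := Set.Infinite.exists_subset_card_eq hinf (K * (2 * m + 1) + 1)
    have := lower m Λ S (by omega) (fun i hi => hS hi)
    linarith
  have : Infinite ι := by
    by_contra hfinite
    rw [not_infinite_iff_finite] at hfinite
    have := Fintype.ofFinite ι
    -- With all indices in `F` the condition off `F` is void, so `Λ` is free; this choice would give
    -- `2 + N² ≤ 1 + N²` for `N` the number of indices.
    have h := upper (Fintype.card ι) (C₁ * (2 + (Fintype.card ι : ℝ) ^ 2)) Finset.univ
      (by positivity) (by rw [Finset.card_univ]; nlinarith) (by simp)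
    rw [inv_mul_cancel_left₀ hC₁.ne'] at h
    linarith
  refine ⟨he.exists_isEigenvalueList hsa hfin, fun lam hlam => ?_⟩
  obtain ⟨σ, hσ⟩ := he.exists_equiv hsa hfin hlam
  have hKr : (0 : ℝ) < K := by exact_mod_cast hK
  refine ⟨(4 * K * √C₂)⁻¹, √(2 * C₁), by positivity, by positivity,
    ⟨2 * K + 1, by omega⟩, fun n hn => ⟨?_, ?_⟩⟩
  · have hn' : 2 * K + 1 ≤ (n : ℕ) := hn
    have hq := Nat.div_add_mod (n : ℕ) (4 * K)
    have hr := Nat.mod_lt (n : ℕ) (show 0 < 4 * K by omega)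
    -- This `m` makes `K(2m + 1) ≤ n/2 + K < n` for `n > 2K`, while `n ≤ 4K(m + 1)`; hence `n² ≤
    -- 16K²C₂λₙ`, which is the choice of `β₁`.
    set m := (n : ℕ) / (4 * K) with hm
    have h := lower m (lam n) ((Finset.Icc 1 n).map σ.toEmbedding) (by
      rw [Finset.card_map, PNat.card_Icc]
      have : ((n : ℕ) + 1 - ((1 : ℕ+) : ℕ)) = n := by simp
      rw [this]
      have h2 : K * (2 * m + 1) * 2 = 4 * K * m + 2 * K := by ring
      omega) (by
      intro i hi
      obtain ⟨k, hk, rfl⟩ := Finset.mem_map.mp hi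
      rw [Equiv.coe_toEmbedding, hσ]
      exact hlam.monotone (Finset.mem_Icc.mp hk).2)
    have hnm : (n : ℝ) ≤ 4 * K * (m + 1) := by
      have : (n : ℕ) ≤ 4 * K * (m + 1) := by rw [mul_add]; omega
      exact_mod_cast this
    rw [inv_pow, inv_mul_le_iff₀ (by positivity), mul_pow, Real.sq_sqrt hC₂.le]
    calc (n : ℝ) ^ 2 ≤ (4 * K * (m + 1)) ^ 2 := by gcongr
      _ = (4 * K) ^ 2 * ((m : ℝ) + 1) ^ 2 := by ring
      _ ≤ (4 * K) ^ 2 * (C₂ * lam n) := by gcongr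
      _ = _ := by ring
  · have hlam0 : 0 < lam n := by
      rw [← hσ]
      exact zero_lt_one.trans_le (hμ1 _)
    -- Only the `n - 1` earlier indices are excluded, and the crude cutoff `m = n` suffices: `λₙ ≤
    -- C₁(1 + n²) ≤ 2C₁n²`, whence `β₂`.
    have h := upper n (lam n) ((Finset.Ico 1 n).map σ.toEmbedding) hlam0 (by
      rw [Finset.card_map, PNat.card_Ico]
      have := n.pos
      have h1 : ((1 : ℕ+) : ℕ) = 1 := rfl
      rw [h1]
      have : (n : ℕ) - 1 < n := by omega
      nlinarith) (by
      intro i hi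
      obtain ⟨k, rfl⟩ := σ.surjective i
      rw [hσ]
      refine hlam.monotone (not_lt.mp fun hk => hi ?_)
      exact Finset.mem_map.mpr ⟨k, Finset.mem_Ico.mpr ⟨one_le, hk⟩, rfl⟩)
    rw [inv_mul_le_iff₀ hC₁] at h
    rw [Real.sq_sqrt (by positivity)]
    have h1 : (1 : ℝ) ≤ n := by exact_mod_cast n.pos
    nlinarith [mul_nonneg hC₁.le (sub_nonneg.mpr (show (1 : ℝ) ≤ (n : ℝ) ^ 2 by nlinarith))]
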